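/- Let $n\ge 1$. All arrays are over $\mathbb{Z}/2\mathbb{Z}$. A Steinhaus triangle of size $m$ is an array $(a_{i,j})_{1\le i\le j\le m}$ with $a_{i,j}=a_{i-1,j-1}+a_{i-1,j}$ for all $2\le i\le j\le m$; it is determined by its first row, and $\nabla S$ denotes the one with first row $S$. Let $r\big((a_{i,j})\big)=(a_{j-i+1,m-i+1})$ be the rotation by $120$ degrees, $h\big((a_{i,j})\big)=(a_{i,m-j+i})$ the horizontal reflection, and $\rho=r^2+r+\mathrm{id}$. Let $\mathcal{DST}_0(m)$ be the space of the Steinhaus triangles of size $m$ that are fixed by $r$ and $h$ and whose first row has an even number of ones. For a binary sequence $S$ of length $n-1$, the Steinhaus graph $G\langle S\rangle$ is the simple graph with vertices $1,\dots,n$ whose adjacency matrix has $\nabla S$ as its strictly upper-triangular part. The Steinhaus graphs of order $n$ form a vector space over $\mathbb{Z}/2\mathbb{Z}$ under addition of adjacency matrices modulo $2$; those all of whose vertex degrees are even form a linear subspace, denoted by $\mathcal{ESG}(n)$. For $(a_{i,j})\in\mathcal{DST}_0(2n-1)$ put $\psi\big((a_{i,j})\big)=G\langle (a_{2,2j})_{1\le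 j\le n-1}\rangle$. For integers $a,b$ let $\binom{a}{b}=0$ if $b<0$ and $\binom{a}{b}=\frac{a(a-1)\cdots(a-b+1)}{b!}$ if $b\ge 0$, and let $B_m^{k}(l)=\left(\binom{l+j-1}{k}\bmod 2\right)_{1\le j\le m}$. Then $\rho\big(\nabla B_{2n-1}^{2k+1}(k-n+1)\big)\in\mathcal{DST}_0(2n-1)$ for all integers $k$ with $0\le k<\lfloor\frac{n-1}{3}\rfloor$, the family of the graphs $$\psi\rho\big(\nabla B_{2n-1}^{2k+1}(k-n+1)\big),\qquad 0\le k<\left\lfloor\tfrac{n-1}{3}\right\rfloor,$$ is a basis of $\mathcal{ESG}(n)$, and $\psi\rho\big(\nabla B_{2n-1}^{2k+1}(k-n+1)\big)=G\langle S_k\rangle$ for each of these $k$, where $$S_k=\left(\binom{k-n+2j-1}{2k}+\binom{k+n-2j}{2k-2j+3}+\binom{k-n+2}{2k-2n+2j+2}\bmod 2\right)_{1\le j\le n-1}.$$ -/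

import Mathlib

noncomputable section

namespace Steinhaus

/-! ## Binomial coefficients with arbitrary integer entries -/

/-- The binomial coefficient of two integers: it is `0` for a negative lower entry, and
`a (a - 1) ⋯ (a - b + 1) / b!` for `b ≥ 0`. -/
def binom (a b : ℤ) : ℤ := if b < 0 then 0 else Ring.choose a b.toNat

theorem binom_zero_right (a : ℤ) : binom a 0 = 1 := by
  simp [binom]

theorem binom_zero_left {b : ℤ} (hb : 0 < b) : binom 0 b = 0 := by
  have h : ¬ b < 0 := by omega
  rw [binom, if_neg h, Ring.choose_zero_pos ℤ (by omega)]

/-- The Pascal rule on all of `ℤ × ℤ`; together with the two boundary rules above it determines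
`binom`. -/
theorem binom_pascal (a b : ℤ) : binom a b = binom (a - 1) (b - 1) + binom (a - 1) b := by
  rcases lt_trichotomy b 0 with h | h | h
  · have h' : b - 1 < 0 := by omega
    simp [binom, h, h']
  · subst h
    simp [binom]
  · have h1 : ¬ b < 0 := by omega
    have h2 : ¬ b - 1 < 0 := by omega
    obtain ⟨m, rfl⟩ : ∃ m : ℕ, b = m + 1 := ⟨(b - 1).toNat, by omega⟩
    have e1 : ((m : ℤ) + 1).toNat = m + 1 := by omega
    have e2 : ((m : ℤ) + 1 - 1).toNat = m := by omega
    rw [binom, binom, binom, if_neg h1, if_neg h1, if_neg h2, e1, e2]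
    have := Ring.choose_succ_succ (a - 1) m
    rwa [sub_add_cancel] at this

/-! ## Binary sequences and Steinhaus triangles -/

/-- The index set `{1, …, n}`. -/
abbrev Idx (n : ℕ) : Type := {j : ℕ // j ∈ Finset.Icc 1 n}

/-- Binary sequences `(a_1, …, a_n)` of length `n`. -/
abbrev BinSeq (n : ℕ) : Type := Idx n → ZMod 2

/-- The index set `{(i, j) | 1 ≤ i ≤ j ≤ n}` of a triangle of size `n`. -/
abbrev TriIdx (n : ℕ) : Type := {p : ℕ × ℕ // 1 ≤ p.1 ∧ p.1 ≤ p.2 ∧ p.2 ≤ n}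

/-- The space of binary Steinhaus triangles of size `n`: the arrays `(a_{i,j})_{1 ≤ i ≤ j ≤ n}`
over `ℤ/2ℤ` such that `a_{i,j} = a_{i-1,j-1} + a_{i-1,j}` for `2 ≤ i ≤ j ≤ n`. -/
def ST (n : ℕ) : Submodule (ZMod 2) (TriIdx n → ZMod 2) where
  carrier := {a | ∀ (i j : ℕ) (hi : 2 ≤ i) (hij : i ≤ j) (hj : j ≤ n),
    a ⟨(i, j), by dsimp only; omega⟩ =
      a ⟨(i - 1, j - 1), by dsimp only; omega⟩ + a ⟨(i - 1, j), by dsimp only; omega⟩}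
  add_mem' := by
    intro a b ha hb i j hi hij hj
    simp only [Pi.add_apply]
    rw [ha i j hi hij hj, hb i j hi hij hj]
    ring
  zero_mem' := by
    intro i j hi hij hj
    simp
  smul_mem' := by
    intro c a ha i j hi hij hj
    simp only [Pi.smul_apply, smul_eq_mul]
    rw [ha i j hi hij hj]
    ring

/-- The first row of a triangle. -/
def firstRow {n : ℕ} (T : ST n) : BinSeq n :=
  fun j => T.1 ⟨(1, j.1), by have := Finset.mem_Icc.1 j.2; dsimp only; omega⟩

/-- `rowAux S i j` is the entry in column `j` of the `i`-th row below the row `S`, computed with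
the local rule. -/
def rowAux (S : ℕ → ZMod 2) : ℕ → ℕ → ZMod 2
  | 0, j => S j
  | i + 1, j => rowAux S i (j - 1) + rowAux S i j

theorem rowAux_add (S S' : ℕ → ZMod 2) (i j : ℕ) :
    rowAux (S + S') i j = rowAux S i j + rowAux S' i j := by
  induction i generalizing j with
  | zero => rfl
  | succ i ih => simp only [rowAux, ih]; ring

theorem rowAux_smul (c : ZMod 2) (S : ℕ → ZMod 2) (i j : ℕ) :
    rowAux (c • S) i j = c * rowAux S i j := by
  induction i generalizing j with
  | zero => rfl
  | succ i ih => simp only [rowAux, ih]; ring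

/-- A sequence `(a_1, …, a_n)`, extended by zero to all of `ℕ`. -/
def extend {n : ℕ} (S : BinSeq n) : ℕ → ZMod 2 :=
  fun j => if h : j ∈ Finset.Icc 1 n then S ⟨j, h⟩ else 0

/-- The Steinhaus triangle `∇S` whose first row is the sequence `S`. -/
def nabla {n : ℕ} : BinSeq n →ₗ[ZMod 2] ST n where
  toFun S := ⟨fun p => rowAux (extend S) (p.1.1 - 1) p.1.2, by
    intro i j hi hij hj
    obtain ⟨m, rfl⟩ : ∃ m, i = m + 2 := ⟨i - 2, by omega⟩
    rfl⟩
  map_add' S S' := by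
    have h : extend (S + S') = extend S + extend S' := by
      funext j
      by_cases hj : j ∈ Finset.Icc 1 n
      · simp only [extend, dif_pos hj, Pi.add_apply]
      · simp only [extend, dif_neg hj, Pi.add_apply, add_zero]
    apply Subtype.ext
    funext p
    simp only [h, rowAux_add]
    rfl
  map_smul' c S := by
    have h : extend (c • S) = c • extend S := by
      funext j
      by_cases hj : j ∈ Finset.Icc 1 n
      · simp only [extend, dif_pos hj, Pi.smul_apply]
      · simp only [extend, dif_neg hj, Pi.smul_apply, smul_zero]
    apply Subtype.ext
    funext p
    simp only [h, rowAux_smul]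
    rfl

theorem firstRow_nabla {n : ℕ} (S : BinSeq n) : firstRow (nabla S) = S := by
  funext j
  change extend S j.1 = S j
  rw [extend, dif_pos j.2]

/-- A Steinhaus triangle is determined by its first row. -/
theorem nabla_firstRow {n : ℕ} (T : ST n) : nabla (firstRow T) = T := by
  apply Subtype.ext
  funext p
  obtain ⟨⟨i, j⟩, h1, h2, h3⟩ := p
  change rowAux (extend (firstRow T)) (i - 1) j = _
  dsimp only at h1 h2 h3
  induction i using Nat.strong_induction_on generalizing j with
  | _ i ih =>
    rcases Nat.lt_or_ge i 2 with hi | hi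
    · obtain rfl : i = 1 := by omega
      change extend (firstRow T) j = _
      rw [extend, dif_pos (Finset.mem_Icc.2 ⟨h2, h3⟩)]
      rfl
    · have hT := T.2 i j hi h2 h3
      rw [hT, ← ih (i - 1) (by omega) (j - 1) (by omega) (by omega) (by omega),
        ← ih (i - 1) (by omega) j (by omega) (by omega) (by omega)]
      obtain ⟨m, rfl⟩ : ∃ m, i = m + 2 := ⟨i - 2, by omega⟩
      rfl

/-! ## Symmetries -/

/-- The rotation by 120 degrees: `(a_{i,j}) ↦ (a_{j-i+1,n-i+1})`. -/
def rot {n : ℕ} : ST n →ₗ[ZMod 2] ST n where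
  toFun T := ⟨fun p => T.1 ⟨(p.1.2 - p.1.1 + 1, n - p.1.1 + 1), by
      have := p.2; dsimp only; omega⟩, by
    intro i j hi hij hj
    have h := T.2 (j - i + 2) (n - i + 2) (by omega) (by omega) (by omega)
    have e1 : j - 1 - (i - 1) + 1 = j - i + 1 := by omega
    have e2 : n - (i - 1) + 1 = n - i + 2 := by omega
    have e3 : j - (i - 1) + 1 = j - i + 2 := by omega
    have e4 : j - i + 2 - 1 = j - i + 1 := by omega
    have e5 : n - i + 2 - 1 = n - i + 1 := by omega
    simp only [e4, e5] at h
    simp only [e1, e2, e3]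
    rw [h, add_left_comm, CharTwo.add_self_eq_zero, add_zero]⟩
  map_add' _ _ := rfl
  map_smul' _ _ := rfl

/-- The horizontal reflection: `(a_{i,j}) ↦ (a_{i,n-j+i})`. -/
def hrefl {n : ℕ} : ST n →ₗ[ZMod 2] ST n where
  toFun T := ⟨fun p => T.1 ⟨(p.1.1, n - p.1.2 + p.1.1), by
      have := p.2; dsimp only; omega⟩, by
    intro i j hi hij hj
    have h := T.2 i (n - j + i) hi (by omega) (by omega)
    have e1 : n - (j - 1) + (i - 1) = n - j + i := by omega
    have e2 : n - j + (i - 1) = n - j + i - 1 := by omega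
    simp only [e1, e2]
    rw [h, add_comm]⟩
  map_add' _ _ := rfl
  map_smul' _ _ := rfl

/-- The linear map `ρ = r² + r + id`, where `r` is the rotation by 120 degrees. -/
def rho {n : ℕ} : ST n →ₗ[ZMod 2] ST n := rot ∘ₗ rot + rot + LinearMap.id

/-- The space of dihedrally symmetric Steinhaus triangles of size `n` (those that are fixed by the
rotation and by the reflection) whose first row has an even sum. -/
def DSTzero (n : ℕ) : Submodule (ZMod 2) (ST n) where
  carrier := {T | rot T = T ∧ hrefl T = T ∧ ∑ j, firstRow T j = 0}
  add_mem' := by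
    rintro T T' ⟨h1, h2, h3⟩ ⟨h1', h2', h3'⟩
    refine ⟨by rw [map_add, h1, h1'], by rw [map_add, h2, h2'], ?_⟩
    change ∑ j, (firstRow T j + firstRow T' j) = 0
    rw [Finset.sum_add_distrib, h3, h3', add_zero]
  zero_mem' := by
    refine ⟨map_zero _, map_zero _, ?_⟩
    change ∑ _j : Idx n, (0 : ZMod 2) = 0
    simp
  smul_mem' := by
    rintro c T ⟨h1, h2, h3⟩
    refine ⟨by rw [map_smul, h1], by rw [map_smul, h2], ?_⟩
    change ∑ j, c * firstRow T j = 0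
    rw [← Finset.mul_sum, h3, mul_zero]

/-! ## Steinhaus graphs -/

open Classical in
/-- The upper-triangular part of the adjacency matrix `(a_{i,j})` of a graph with vertices
`1, …, n`, as a triangle of size `n - 1`: its entry at `(i, j)` is `a_{i,j+1}`. -/
def upperPart {n : ℕ} (G : SimpleGraph (Idx n)) : TriIdx (n - 1) → ZMod 2 :=
  fun p => G.adjMatrix (ZMod 2)
    ⟨p.1.1, Finset.mem_Icc.2 (by have := p.2; omega)⟩
    ⟨p.1.2 + 1, Finset.mem_Icc.2 (by have := p.2; omega)⟩

/-- The Steinhaus graphs of order `n`: the simple graphs with vertices `1, …, n` for which the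
upper-triangular part of the adjacency matrix is a Steinhaus triangle. -/
def SG (n : ℕ) : Type := {G : SimpleGraph (Idx n) // upperPart G ∈ ST (n - 1)}

/-- The graph with vertices `1, …, n` whose adjacency matrix has a given upper-triangular part. -/
def graphOfUpper {n : ℕ} (a : TriIdx (n - 1) → ZMod 2) : SimpleGraph (Idx n) where
  Adj u v := ∃ p : TriIdx (n - 1), a p = 1 ∧
    ((p.1.1 = u.1 ∧ p.1.2 + 1 = v.1) ∨ (p.1.1 = v.1 ∧ p.1.2 + 1 = u.1))
  symm := ⟨by
    rintro u v ⟨p, hp, h⟩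
    exact ⟨p, hp, h.symm⟩⟩
  loopless := ⟨by
    rintro u ⟨p, hp, h⟩
    have := p.2
    omega⟩

theorem upperPart_graphOfUpper {n : ℕ} (a : TriIdx (n - 1) → ZMod 2) :
    upperPart (graphOfUpper a) = a := by
  classical
  funext p
  have h01 : ∀ x : ZMod 2, x = 0 ∨ x = 1 := by decide
  rw [upperPart, SimpleGraph.adjMatrix_apply]
  split_ifs with h
  · obtain ⟨q, hq, h⟩ := h
    have hp2 := p.2
    have hq2 := q.2
    have : q = p := by
      apply Subtype.ext
      apply Prod.ext <;> dsimp only at h <;> omega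
    rw [← this, hq]
  · rcases h01 (a p) with h0 | h1
    · exact h0.symm
    · exact absurd ⟨p, h1, Or.inl ⟨rfl, rfl⟩⟩ h

theorem graphOfUpper_upperPart {n : ℕ} (G : SimpleGraph (Idx n)) :
    graphOfUpper (upperPart G) = G := by
  classical
  have key : ∀ p : TriIdx (n - 1), upperPart G p = 1 ↔
      G.Adj ⟨p.1.1, Finset.mem_Icc.2 (by have := p.2; omega)⟩
        ⟨p.1.2 + 1, Finset.mem_Icc.2 (by have := p.2; omega)⟩ := by
    intro p
    rw [upperPart, SimpleGraph.adjMatrix_apply]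
    split_ifs with h <;> simp [h]
  ext u v
  constructor
  · rintro ⟨p, hp, ⟨h1, h2⟩ | ⟨h1, h2⟩⟩
    · have := (key p).1 hp
      simpa only [h1, h2] using this
    · have := ((key p).1 hp).symm
      simpa only [h1, h2] using this
  · intro h
    have hu := Finset.mem_Icc.1 u.2
    have hv := Finset.mem_Icc.1 v.2
    rcases lt_trichotomy u.1 v.1 with hlt | heq | hlt
    · refine ⟨⟨(u.1, v.1 - 1), by dsimp only; omega⟩, (key _).2 ?_, Or.inl ⟨rfl, ?_⟩⟩
      · have e : v.1 - 1 + 1 = v.1 := by omega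
        simpa only [e] using h
      · dsimp only; omega
    · exact absurd (Subtype.ext heq) h.ne
    · refine ⟨⟨(v.1, u.1 - 1), by dsimp only; omega⟩, (key _).2 ?_, Or.inr ⟨rfl, ?_⟩⟩
      · have e : u.1 - 1 + 1 = u.1 := by omega
        simpa only [e] using h.symm
      · dsimp only; omega

/-- The natural correspondence between Steinhaus graphs of order `n` and Steinhaus triangles of
size `n - 1`. -/
def SG.equivST (n : ℕ) : SG n ≃ ST (n - 1) where
  toFun G := ⟨upperPart G.1, G.2⟩
  invFun T := ⟨graphOfUpper T.1, by rw [upperPart_graphOfUpper]; exact T.2⟩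
  left_inv G := Subtype.ext (graphOfUpper_upperPart G.1)
  right_inv T := Subtype.ext (upperPart_graphOfUpper T.1)

/-- Steinhaus graphs are added by adding adjacency matrices modulo `2`. -/
instance (n : ℕ) : AddCommGroup (SG n) := (SG.equivST n).addCommGroup

instance (n : ℕ) : Module (ZMod 2) (SG n) := (SG.equivST n).module (ZMod 2)

/-- The natural correspondence as a linear isomorphism. -/
def SG.linearEquivST (n : ℕ) : SG n ≃ₗ[ZMod 2] ST (n - 1) := (SG.equivST n).linearEquiv (ZMod 2)

/-- The Steinhaus graph `G⟨S⟩` associated with a binary sequence `S` of length `n - 1`. -/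
def steinhausGraph (n : ℕ) : BinSeq (n - 1) →ₗ[ZMod 2] SG n :=
  (SG.linearEquivST n).symm.toLinearMap ∘ₗ nabla

open Classical in
/-- The adjacency matrix of a Steinhaus graph, modulo `2`. -/
def SG.adj {n : ℕ} (G : SG n) : Matrix (Idx n) (Idx n) (ZMod 2) := G.1.adjMatrix (ZMod 2)

theorem SG.adj_symm {n : ℕ} (G : SG n) (u v : Idx n) : G.adj u v = G.adj v u := by
  classical exact (SimpleGraph.isSymm_adjMatrix G.1).apply v u

theorem SG.adj_self {n : ℕ} (G : SG n) (u : Idx n) : G.adj u u = 0 := by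
  simp [SG.adj, SimpleGraph.adjMatrix_apply]

theorem SG.adj_of_lt {n : ℕ} (G : SG n) {u v : Idx n} (h : u.1 < v.1) :
    G.adj u v = (SG.linearEquivST n G).1 ⟨(u.1, v.1 - 1), by
      have hu := Finset.mem_Icc.1 u.2
      have hv := Finset.mem_Icc.1 v.2
      dsimp only; omega⟩ := by
  have e : v.1 - 1 + 1 = v.1 := by omega
  change _ = upperPart G.1 _
  simp only [upperPart, SG.adj, e]

theorem SG.adj_linear {n : ℕ} (c : ZMod 2) (G H : SG n) :
    (c • G + H).adj = c • G.adj + H.adj := by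
  have key : ∀ u v : Idx n, u.1 < v.1 →
      (c • G + H).adj u v = c * G.adj u v + H.adj u v := by
    intro u v h
    rw [SG.adj_of_lt _ h, SG.adj_of_lt _ h, SG.adj_of_lt _ h, map_add, map_smul]
    rfl
  ext u v
  simp only [Matrix.add_apply, Matrix.smul_apply, smul_eq_mul]
  rcases lt_trichotomy u.1 v.1 with h | h | h
  · exact key u v h
  · obtain rfl : u = v := Subtype.ext h
    simp only [SG.adj_self, mul_zero, add_zero]
  · rw [SG.adj_symm _ u v, SG.adj_symm G u v, SG.adj_symm H u v]
    exact key v u h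

theorem SG.adj_add {n : ℕ} (G H : SG n) : (G + H).adj = G.adj + H.adj := by
  have := SG.adj_linear 1 G H
  rwa [one_smul, one_smul] at this

open Classical in
/-- A Steinhaus graph is even if every vertex has even degree. -/
def SG.IsEven {n : ℕ} (G : SG n) : Prop := ∀ v, Even (G.1.degree v)

theorem SG.isEven_iff {n : ℕ} (G : SG n) : G.IsEven ↔ ∀ u, ∑ v, G.adj u v = 0 := by
  classical
  unfold SG.IsEven
  refine forall_congr' fun u => ?_
  have h : ∑ v, G.adj u v = ((G.1.degree u : ℕ) : ZMod 2) := by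
    simp only [SG.adj, SimpleGraph.adjMatrix_apply, Finset.sum_boole]
    congr 2
    ext v
    simp
  rw [h, ZMod.natCast_eq_zero_iff_even]

/-- The linear subspace of even Steinhaus graphs of order `n`. -/
def ESG (n : ℕ) : Submodule (ZMod 2) (SG n) where
  carrier := {G | G.IsEven}
  add_mem' := by
    intro G H hG hH
    rw [Set.mem_ofPred_eq, SG.isEven_iff] at *
    intro u
    simp only [SG.adj_add, Matrix.add_apply, Finset.sum_add_distrib, hG u, hH u, add_zero]
  zero_mem' := by
    rw [Set.mem_ofPred_eq, SG.isEven_iff]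
    have h0 : (0 : SG n).adj = 0 := by simpa using SG.adj_add (0 : SG n) 0
    intro u
    simp [h0]
  smul_mem' := by
    intro c G hG
    rw [Set.mem_ofPred_eq, SG.isEven_iff] at *
    have h0 : (0 : SG n).adj = 0 := by simpa using SG.adj_add (0 : SG n) 0
    intro u
    have h := SG.adj_linear c G 0
    rw [add_zero, h0, add_zero] at h
    simp only [h, Matrix.smul_apply, smul_eq_mul, ← Finset.mul_sum, hG u, mul_zero]

/-! ## The map `ψ` and the sequences of the basis -/

/-- The linear map `ψ : (a_{i,j})_{1 ≤ i ≤ j ≤ 2n-1} ↦ G⟨(a_{2,2j})_{1 ≤ j ≤ n-1}⟩`, on dihedrally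
symmetric Steinhaus triangles of size `2n - 1` with an even sum in the first row. -/
def psi (n : ℕ) : DSTzero (2 * n - 1) →ₗ[ZMod 2] SG n where
  toFun T := steinhausGraph n fun j => T.1.1 ⟨(2, 2 * j.1), by
    have := Finset.mem_Icc.1 j.2; dsimp only; omega⟩
  map_add' T T' := by rw [← map_add]; rfl
  map_smul' c T := by rw [RingHom.id_apply, ← map_smul]; rfl

/-- The sequence of the residues modulo `2` of `binom l k, binom (l+1) k, …, binom (l+n-1) k`. -/
def pascalColumn (n : ℕ) (k l : ℤ) : BinSeq n :=
  fun j => ((binom (l + j.1 - 1) k : ℤ) : ZMod 2)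

/-- The sequence `S_k` of length `n - 1`. -/
def basisSeq (n k : ℕ) : BinSeq (n - 1) :=
  fun j => ((binom ((k : ℤ) - n + 2 * j.1 - 1) (2 * k) +
    binom ((k : ℤ) + n - 2 * j.1) (2 * k - 2 * j.1 + 3) +
    binom ((k : ℤ) - n + 2) (2 * k - 2 * n + 2 * j.1 + 2) : ℤ) : ZMod 2)

end Steinhaus

end

open Steinhaus

open Steinhaus

/-! The map `psi n` is an isomorphism from `DSTzero (2 * n - 1)` onto `ESG n`, so it suffices to
find a basis of the former.

For the isomorphism, let T have size 2n-1, be fixed by `hrefl` and vanish in the middle of its first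
row. The entries of T with both indices even form a Steinhaus triangle of size n-1, and every
sequence S arises from such a T. Pairing neighbouring entries shows that the degree of vertex v is,
mod 2, the sum of column 2v-1 plus its first entry plus the last entry of row 2v-1 (`mem_ESG_iff`).
Dihedral symmetry makes this vanish. Conversely, even degrees force every column to be symmetric,
column by column, and two reflections generate the rotation (`mem_DSTzero_of_mem_ESG`).

For the basis, put s = (n-1)/3. A triangle in `DSTzero (2 * n - 1)` is zero as soon as the s entries
left of the middle of its first row are: the zeros propagate downwards, and rotation carries them
back to the first row (`entry_one_next_eq_zero`). Hence the dimension is at most s. The s triangles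
`rho (binomTriangle n k)` lie in the space because of upper negation of binomial coefficients mod 2,
and their entries at (2K+2, 4K+4) form a unitriangular matrix (`entry_rho_binomTriangle_pivot`). -/

namespace Steinhaus

/-! ## Entries of triangles as total functions -/

/-- The entry `(i, j)` of a triangle, extended by zero to all of `ℕ × ℕ`. -/
def entry {m : ℕ} (T : ST m) (i j : ℕ) : ZMod 2 :=
  if h : 1 ≤ i ∧ i ≤ j ∧ j ≤ m then T.1 ⟨(i, j), h⟩ else 0

theorem entry_of_mem {m : ℕ} (T : ST m) {i j : ℕ} (h : 1 ≤ i ∧ i ≤ j ∧ j ≤ m) :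
    entry T i j = T.1 ⟨(i, j), h⟩ := dif_pos h

theorem entry_zero {m : ℕ} (i j : ℕ) : entry (0 : ST m) i j = 0 := by
  unfold entry
  split_ifs <;> rfl

theorem entry_add {m : ℕ} (T U : ST m) (i j : ℕ) :
    entry (T + U) i j = entry T i j + entry U i j := by
  unfold entry
  split_ifs
  · rfl
  · simp

theorem entry_smul {m : ℕ} (c : ZMod 2) (T : ST m) (i j : ℕ) :
    entry (c • T) i j = c * entry T i j := by
  unfold entry
  split_ifs
  · rfl
  · simp

/-- The entry at a fixed position as a linear functional. -/
def entryFunctional {m : ℕ} (i j : ℕ) : ST m →ₗ[ZMod 2] ZMod 2 where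
  toFun T := entry T i j
  map_add' T U := entry_add T U i j
  map_smul' c T := entry_smul c T i j

theorem entry_succ_succ {m : ℕ} (T : ST m) {i j : ℕ} (hi : 1 ≤ i) (hij : i ≤ j) (hj : j + 1 ≤ m) :
    entry T (i + 1) (j + 1) = entry T i j + entry T i (j + 1) := by
  rw [entry_of_mem T (by omega : 1 ≤ i + 1 ∧ i + 1 ≤ j + 1 ∧ j + 1 ≤ m),
    entry_of_mem T (by omega : 1 ≤ i ∧ i ≤ j ∧ j ≤ m),
    entry_of_mem T (by omega : 1 ≤ i ∧ i ≤ j + 1 ∧ j + 1 ≤ m)]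
  exact T.2 (i + 1) (j + 1) (by omega) (by omega) hj

theorem ST_ext {m : ℕ} {T U : ST m}
    (h : ∀ i j, 1 ≤ i → i ≤ j → j ≤ m → entry T i j = entry U i j) : T = U := by
  apply Subtype.ext
  funext p
  obtain ⟨⟨i, j⟩, hp⟩ := p
  have := h i j hp.1 hp.2.1 hp.2.2
  rwa [entry_of_mem T hp, entry_of_mem U hp] at this

theorem firstRow_apply {m : ℕ} (T : ST m) (j : Idx m) : firstRow T j = entry T 1 j.1 := by
  have := Finset.mem_Icc.1 j.2
  rw [entry_of_mem T (by omega : 1 ≤ 1 ∧ 1 ≤ j.1 ∧ j.1 ≤ m)]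
  rfl

theorem ST_ext_firstRow {m : ℕ} {T U : ST m}
    (h : ∀ j, 1 ≤ j → j ≤ m → entry T 1 j = entry U 1 j) : T = U := by
  rw [← nabla_firstRow T, ← nabla_firstRow U]
  congr 1
  funext j
  have := Finset.mem_Icc.1 j.2
  rw [firstRow_apply, firstRow_apply, h j.1 this.1 this.2]

theorem entry_nabla_one {m : ℕ} (S : BinSeq m) {j : ℕ} (hj : j ∈ Finset.Icc 1 m) :
    entry (nabla S) 1 j = S ⟨j, hj⟩ := by
  rw [← firstRow_apply (nabla S) ⟨j, hj⟩, firstRow_nabla]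

theorem entry_rot {m : ℕ} (T : ST m) {i j : ℕ} (hi : 1 ≤ i) (hij : i ≤ j) (hj : j ≤ m) :
    entry (rot T) i j = entry T (j - i + 1) (m - i + 1) := by
  rw [entry_of_mem _ ⟨hi, hij, hj⟩, entry_of_mem T (by omega)]
  rfl

theorem entry_hrefl {m : ℕ} (T : ST m) {i j : ℕ} (hi : 1 ≤ i) (hij : i ≤ j) (hj : j ≤ m) :
    entry (hrefl T) i j = entry T i (m - j + i) := by
  rw [entry_of_mem _ ⟨hi, hij, hj⟩, entry_of_mem T (by omega)]
  rfl

theorem entry_rot_rot {m : ℕ} (T : ST m) {i j : ℕ} (hi : 1 ≤ i) (hij : i ≤ j) (hj : j ≤ m) :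
    entry (rot (rot T)) i j = entry T (m - j + 1) (m - j + i) := by
  rw [entry_rot _ hi hij hj, entry_rot T (by omega) (by omega) (by omega)]
  congr 1 <;> omega

theorem rot_rot_rot {m : ℕ} (T : ST m) : rot (rot (rot T)) = T := by
  refine ST_ext fun i j hi hij hj => ?_
  rw [entry_rot_rot _ hi hij hj, entry_rot T (by omega) (by omega) (by omega)]
  congr 1 <;> omega

theorem hrefl_rot {m : ℕ} (T : ST m) : hrefl (rot T) = rot (rot (hrefl T)) := by
  refine ST_ext fun i j hi hij hj => ?_
  rw [entry_hrefl _ hi hij hj, entry_rot T (by omega) (by omega) (by omega),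
    entry_rot_rot _ hi hij hj, entry_hrefl T (by omega) (by omega) (by omega)]
  congr 1 <;> omega

theorem rho_apply {m : ℕ} (T : ST m) : rho T = rot (rot T) + rot T + T := rfl

theorem rot_rho {m : ℕ} (T : ST m) : rot (rho T) = rho T := by
  simp only [rho_apply, map_add, rot_rot_rot]
  abel

theorem hrefl_rho {m : ℕ} {T : ST m} (h : hrefl T = T) : hrefl (rho T) = rho T := by
  simp only [rho_apply, map_add, hrefl_rot, h, rot_rot_rot]
  abel

theorem entry_eq_zero_of_row {m : ℕ} (T : ST m) {p q r : ℕ} (hr : 1 ≤ r) (hp : r ≤ p) (hq : q ≤ m)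
    (h : ∀ j, p ≤ j → j ≤ q → entry T r j = 0) (d j : ℕ) (hj : p + d ≤ j) (hjq : j ≤ q) :
    entry T (r + d) j = 0 := by
  induction d generalizing j with
  | zero => exact h j hj hjq
  | succ d ih =>
    obtain ⟨j, rfl⟩ : ∃ k, j = k + 1 := ⟨j - 1, by omega⟩
    rw [← add_assoc, entry_succ_succ T (by omega) (by omega) (by omega), ih j (by omega) (by omega),
      ih (j + 1) (by omega) (by omega), add_zero]

/-! ## Sums of symmetric sequences modulo two -/

theorem sum_Icc_of_symm {f : ℕ → ZMod 2} {a b : ℕ}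
    (hf : ∀ q, a ≤ q → q ≤ b → f (a + b - q) = f q) (hab : Odd (a + b)) :
    ∑ q ∈ Finset.Icc a b, f q = 0 := by
  obtain ⟨c, hc⟩ := hab
  refine Finset.sum_involution (fun q _ => a + b - q) ?_ ?_ ?_ ?_
  · intro q hq
    rw [Finset.mem_Icc] at hq
    rw [hf q hq.1 hq.2, CharTwo.add_self_eq_zero]
  · intro q hq _
    rw [Finset.mem_Icc] at hq
    omega
  · intro q hq
    rw [Finset.mem_Icc] at hq ⊢
    omega
  · intro q hq
    rw [Finset.mem_Icc] at hq
    omega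

/-- The reflection cancels the entries in pairs; only its fixed point c survives. -/
theorem sum_Icc_of_symm_middle {f : ℕ → ZMod 2} {a b c : ℕ}
    (hf : ∀ q, a ≤ q → q ≤ b → f (a + b - q) = f q) (hc : a + b = 2 * c) (hab : a ≤ b) :
    ∑ q ∈ Finset.Icc a b, f q = f c := by
  have hmem : c ∈ Finset.Icc a b := by rw [Finset.mem_Icc]; omega
  rw [← Finset.add_sum_erase _ _ hmem, add_eq_left]
  refine Finset.sum_involution (fun q _ => a + b - q) ?_ ?_ ?_ ?_
  · intro q hq
    rw [Finset.mem_erase, Finset.mem_Icc] at hq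
    rw [hf q hq.2.1 hq.2.2, CharTwo.add_self_eq_zero]
  · intro q hq _
    rw [Finset.mem_erase, Finset.mem_Icc] at hq
    omega
  · intro q hq
    rw [Finset.mem_erase, Finset.mem_Icc] at hq ⊢
    omega
  · intro q hq
    rw [Finset.mem_erase, Finset.mem_Icc] at hq
    omega

theorem sum_Ico_pairs (f : ℕ → ZMod 2) {a b : ℕ} (hab : a ≤ b) :
    ∑ q ∈ Finset.Ico a b, (f (2 * q) + f (2 * q + 1)) = ∑ q ∈ Finset.Ico (2 * a) (2 * b), f q := by
  induction b, hab using Nat.le_induction with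
  | base => simp
  | succ b hb ih =>
    rw [Finset.sum_Ico_succ_top hb, ih, show 2 * (b + 1) = 2 * b + 1 + 1 by ring,
      Finset.sum_Ico_succ_top (by omega), Finset.sum_Ico_succ_top (by omega), add_assoc]

theorem sum_Idx {n : ℕ} (f : ℕ → ZMod 2) : ∑ j : Idx n, f j.1 = ∑ j ∈ Finset.Icc 1 n, f j :=
  Finset.sum_coe_sort (Finset.Icc 1 n) f

/-! ## Dihedrally symmetric triangles -/

theorem entry_of_rot_eq {m : ℕ} {T : ST m} (h : rot T = T) {i j : ℕ} (hi : 1 ≤ i) (hij : i ≤ j)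
    (hj : j ≤ m) : entry T (j - i + 1) (m - i + 1) = entry T i j := by
  rw [← entry_rot T hi hij hj, h]

theorem entry_of_rot_rot_eq {m : ℕ} {T : ST m} (h : rot T = T) {i j : ℕ} (hi : 1 ≤ i) (hij : i ≤ j)
    (hj : j ≤ m) : entry T (m - j + 1) (m - j + i) = entry T i j := by
  rw [← entry_rot_rot T hi hij hj, h, h]

theorem entry_of_hrefl_eq {m : ℕ} {T : ST m} (h : hrefl T = T) {i j : ℕ} (hi : 1 ≤ i)
    (hij : i ≤ j) (hj : j ≤ m) : entry T i (m - j + i) = entry T i j := by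
  rw [← entry_hrefl T hi hij hj, h]

/-- Composing the rotation with `hrefl` gives the reflection that reverses every column. -/
theorem entry_column_symm {m : ℕ} {T : ST m} (hr : rot T = T) (hh : hrefl T = T) {i j : ℕ}
    (hi : 1 ≤ i) (hij : i ≤ j) (hj : j ≤ m) : entry T (j - i + 1) j = entry T i j := by
  rw [← entry_of_rot_eq hr hi hij hj,
    ← entry_of_hrefl_eq hh (by omega : 1 ≤ j - i + 1) (by omega : j - i + 1 ≤ m - i + 1) (by omega)]
  congr 1
  omega

/-- The two reflections, of rows and of columns, compose to the rotation. -/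
theorem rot_eq_of_column_symm {m : ℕ} {T : ST m} (hh : hrefl T = T)
    (hc : ∀ i j, 1 ≤ i → i ≤ j → j ≤ m → entry T (j - i + 1) j = entry T i j) : rot T = T := by
  refine ST_ext fun i j hi hij hj => ?_
  rw [entry_rot T hi hij hj, ← hc i j hi hij hj,
    ← entry_of_hrefl_eq hh (by omega : 1 ≤ j - i + 1) (by omega : j - i + 1 ≤ m - i + 1) (by omega)]
  congr 1
  omega

theorem sum_firstRow_of_hrefl_eq {n : ℕ} (hn : 1 ≤ n) {T : ST (2 * n - 1)} (h : hrefl T = T) :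
    ∑ j, firstRow T j = entry T 1 n := by
  simp only [firstRow_apply]
  rw [sum_Idx (fun j => entry T 1 j)]
  refine sum_Icc_of_symm_middle (fun q h1 h2 => ?_) (by omega) (by omega)
  rw [← entry_of_hrefl_eq h le_rfl h1 h2]
  congr 1
  omega

theorem mem_DSTzero_iff {n : ℕ} (hn : 1 ≤ n) {T : ST (2 * n - 1)} :
    T ∈ DSTzero (2 * n - 1) ↔ rot T = T ∧ hrefl T = T ∧ entry T 1 n = 0 := by
  change (rot T = T ∧ hrefl T = T ∧ ∑ j, firstRow T j = 0) ↔ _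
  constructor
  · rintro ⟨h1, h2, h3⟩
    exact ⟨h1, h2, by rwa [sum_firstRow_of_hrefl_eq hn h2] at h3⟩
  · rintro ⟨h1, h2, h3⟩
    exact ⟨h1, h2, by rwa [sum_firstRow_of_hrefl_eq hn h2]⟩

/-! ## Binomial triangles -/

theorem binom_of_neg (a : ℤ) {b : ℤ} (hb : b < 0) : binom a b = 0 := if_pos hb

/-- Upper negation; its sign disappears mod 2. -/
theorem binom_neg_mod_two (a b : ℤ) : (binom a b : ZMod 2) = (binom (b - 1 - a) b : ZMod 2) := by
  rcases lt_or_ge b 0 with h | h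
  · rw [binom_of_neg _ h, binom_of_neg _ h]
  · obtain ⟨b, rfl⟩ := Int.eq_ofNat_of_zero_le h
    have hb : ¬ ((b : ℤ) < 0) := by omega
    rw [binom, binom, if_neg hb, if_neg hb, Int.toNat_natCast]
    have := Ring.choose_neg ((b : ℤ) - 1 - a) b
    rw [show (-((b : ℤ) - 1 - a) : ℤ) = a + 1 - b by ring,
      show ((b : ℤ) - 1 - a + b - 1) = 2 * b - 2 - a by ring] at this
    have h2 := Ring.choose_neg (-a) b
    rw [neg_neg, show (-a + b - 1 : ℤ) = b - 1 - a by ring] at h2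
    rw [h2]
    rcases Int.even_or_odd (b : ℤ) with hb | hb
    · rw [Int.negOnePow_even _ hb, one_smul]
    · rw [Int.negOnePow_odd _ hb, Units.neg_smul, one_smul, Int.cast_neg, CharTwo.neg_eq]

theorem binom_eq_zero_of_lt {a : ℕ} {b : ℤ} (h : (a : ℤ) < b) : binom a b = 0 := by
  obtain ⟨b, rfl⟩ := Int.eq_ofNat_of_zero_le (by omega : 0 ≤ b)
  rw [binom, if_neg (by omega), Int.toNat_natCast, Ring.choose_natCast,
    Nat.choose_eq_zero_of_lt (by omega), Nat.cast_zero]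

/-- By Pascal's rule, the sum mod 2 of two neighbours in a column of Pascal's triangle lies in the
previous column, so each step down lowers k by one. -/
theorem entry_nabla_pascalColumn (m : ℕ) (k l : ℤ) {i j : ℕ} (hi : 1 ≤ i) (hij : i ≤ j)
    (hj : j ≤ m) :
    entry (nabla (pascalColumn m k l)) i j = (binom (l + j - i) (k - i + 1) : ZMod 2) := by
  induction i, hi using Nat.le_induction generalizing j with
  | base =>
    rw [entry_nabla_one _ (Finset.mem_Icc.2 ⟨hij, hj⟩), pascalColumn]
    congr 2
    push_cast
    ring
  | succ i hi ih =>
    obtain ⟨j, rfl⟩ : ∃ d, j = d + 1 := ⟨j - 1, by omega⟩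
    rw [entry_succ_succ _ hi (by omega) hj, ih (by omega) (by omega), ih (by omega) (by omega),
      binom_pascal (l + ((j + 1 : ℕ) : ℤ) - i) (k - i + 1)]
    push_cast
    rw [show l + (j + 1 : ℤ) - i - 1 = l + j - i by ring,
      show l + (j + 1 : ℤ) - (i + 1) = l + j - i by ring,
      show k - i + 1 - 1 = k - (i + 1 : ℤ) + 1 by ring, add_comm, add_assoc,
      CharTwo.add_self_eq_zero, add_zero]

/-- The triangles whose images under `rho` form the basis. -/
def binomTriangle (n k : ℕ) : ST (2 * n - 1) :=
  nabla (pascalColumn (2 * n - 1) (2 * (k : ℤ) + 1) ((k : ℤ) - n + 1))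

theorem entry_binomTriangle (n k : ℕ) {i j : ℕ} (hi : 1 ≤ i) (hij : i ≤ j) (hj : j ≤ 2 * n - 1) :
    entry (binomTriangle n k) i j = (binom ((k : ℤ) - n + 1 + j - i) (2 * k + 2 - i) : ZMod 2) := by
  rw [binomTriangle, entry_nabla_pascalColumn _ _ _ hi hij hj]
  congr 2
  ring

/-- The offset k-n+1 is chosen so that upper negation is exactly the reflection of each row. -/
theorem hrefl_binomTriangle (n k : ℕ) : hrefl (binomTriangle n k) = binomTriangle n k := by
  refine ST_ext fun i j hi hij hj => ?_
  rw [entry_hrefl _ hi hij hj, entry_binomTriangle n k (by omega) (by omega) (by omega),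
    entry_binomTriangle n k hi hij hj, binom_neg_mod_two]
  congr 2
  omega

theorem entry_rho_binomTriangle (n k : ℕ) {i j : ℕ} (hi : 1 ≤ i) (hij : i ≤ j)
    (hj : j ≤ 2 * n - 1) :
    entry (rho (binomTriangle n k)) i j =
      (binom ((k : ℤ) - n + 1 + j - i) (2 * k + 2 - i) : ZMod 2) +
      (binom ((k : ℤ) + n - j) (2 * k + 1 + i - j) : ZMod 2) +
      (binom ((k : ℤ) - n + i) (2 * k + 2 + j - 2 * n) : ZMod 2) := by
  rw [rho_apply, entry_add, entry_add, entry_rot_rot _ hi hij hj, entry_rot _ hi hij hj,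
    entry_binomTriangle n k hi hij hj, entry_binomTriangle n k (by omega) (by omega) (by omega),
    entry_binomTriangle n k (by omega) (by omega) (by omega)]
  have e1 : (k : ℤ) - n + 1 + ((2 * n - 1 - i + 1 : ℕ) : ℤ) - ((j - i + 1 : ℕ) : ℤ) = k + n - j := by
    omega
  have e2 : 2 * (k : ℤ) + 2 - ((j - i + 1 : ℕ) : ℤ) = 2 * k + 1 + i - j := by omega
  have e3 : (k : ℤ) - n + 1 + ((2 * n - 1 - j + i : ℕ) : ℤ) - ((2 * n - 1 - j + 1 : ℕ) : ℤ)
      = k - n + i := by omega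
  have e4 : 2 * (k : ℤ) + 2 - ((2 * n - 1 - j + 1 : ℕ) : ℤ) = 2 * k + 2 + j - 2 * n := by omega
  rw [e1, e2, e3, e4]
  ring

theorem rho_binomTriangle_mem {n : ℕ} (hn : 1 ≤ n) (k : ℕ) :
    rho (binomTriangle n k) ∈ DSTzero (2 * n - 1) := by
  refine (mem_DSTzero_iff hn).2 ⟨rot_rho _, hrefl_rho (hrefl_binomTriangle n k), ?_⟩
  rw [entry_rho_binomTriangle n k le_rfl hn (by omega)]
  have e1 : (k : ℤ) - n + 1 + n - (1 : ℕ) = k := by push_cast; ring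
  have e2 : (k : ℤ) + n - n = k := by ring
  -- The first term is a binomial coefficient of k over 2k+1, hence zero; upper negation turns the
  -- second into the third.
  rw [e1, e2, binom_eq_zero_of_lt (by push_cast; omega), binom_neg_mod_two (k : ℤ)]
  have e3 : 2 * (k : ℤ) + 1 + (1 : ℕ) - n - 1 - k = k - n + (1 : ℕ) := by push_cast; ring
  have e4 : 2 * (k : ℤ) + 1 + (1 : ℕ) - n = 2 * k + 2 + n - 2 * n := by push_cast; ring
  rw [e3, e4, add_assoc, CharTwo.add_self_eq_zero, Int.cast_zero, zero_add]

/-! ### Linear independence of the binomial triangles -/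

/-- The two rotated terms have negative lower entries here, and the remaining lower entry is 2(k-K),
which is negative unless k = K. -/
theorem entry_rho_binomTriangle_pivot {n k K : ℕ} (hkK : k ≤ K) (hK : 3 * K + 4 ≤ n) :
    entry (rho (binomTriangle n k)) (2 * K + 2) (4 * K + 4) = if k = K then 1 else 0 := by
  rw [entry_rho_binomTriangle n k (by omega) (by omega) (by omega),
    binom_of_neg _ (by push_cast; omega : 2 * (k : ℤ) + 1 + (2 * K + 2 : ℕ) - (4 * K + 4 : ℕ) < 0),
    binom_of_neg _ (by push_cast; omega : 2 * (k : ℤ) + 2 + (4 * K + 4 : ℕ) - 2 * n < 0),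
    Int.cast_zero, add_zero, add_zero]
  split_ifs with h
  · subst h
    rw [show 2 * (k : ℤ) + 2 - (2 * k + 2 : ℕ) = 0 by push_cast; ring, binom_zero_right,
      Int.cast_one]
  · rw [binom_of_neg _ (by push_cast; omega), Int.cast_zero]

/-- In a vanishing combination, the functional of the largest index with nonzero coefficient
isolates that coefficient. -/
theorem linearIndependent_of_pivot {K V : Type*} [Field K] [AddCommGroup V] [Module K V] {s : ℕ}
    (v : Fin s → V) (φ : Fin s → V →ₗ[K] K) (h1 : ∀ i, φ i (v i) = 1)
    (h0 : ∀ i j, j < i → φ i (v j) = 0) : LinearIndependent K v := by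
  rw [Fintype.linearIndependent_iff]
  intro g hg
  by_contra! hne
  obtain ⟨i, hi, hmax⟩ := Set.Finite.exists_maximal (Set.toFinite {i | g i ≠ 0}) hne
  apply hi
  have := congrArg (φ i) hg
  rw [map_sum, map_zero, Finset.sum_eq_single i, map_smul, h1, smul_eq_mul, mul_one] at this
  · exact this
  · intro j _ hji
    rw [map_smul]
    rcases lt_or_gt_of_ne hji with hlt | hgt
    · rw [h0 i j hlt, smul_zero]
    · have : g j = 0 := by
        by_contra hj
        exact absurd (hmax hj hgt.le) (not_le.2 hgt)
      rw [this, zero_smul]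
  · simp

theorem linearIndependent_rho_binomTriangle (n : ℕ) :
    LinearIndependent (ZMod 2) fun k : Fin ((n - 1) / 3) => rho (binomTriangle n k) := by
  refine linearIndependent_of_pivot _ (fun K => entryFunctional (2 * K + 2) (4 * K + 4)) ?_ ?_
  · intro K
    have := K.2
    change entry _ _ _ = _
    rw [entry_rho_binomTriangle_pivot le_rfl (by omega), if_pos rfl]
  · intro K k hk
    have := K.2
    rw [Fin.lt_def] at hk
    change entry _ _ _ = _
    rw [entry_rho_binomTriangle_pivot hk.le (by omega), if_neg hk.ne]

/-! ## The dimension of the space of dihedrally symmetric triangles -/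

theorem entry_eq_zero_of_middle {n s : ℕ} {T : ST (2 * n - 1)} (hsn : s + 1 ≤ n)
    (h : ∀ j, n - s ≤ j → j ≤ n + s → entry T 1 j = 0) {i j : ℕ} (hi : 1 ≤ i)
    (h1 : n - s + i ≤ j + 1) (h2 : j ≤ n + s) : entry T i j = 0 := by
  obtain ⟨d, rfl⟩ : ∃ d, i = 1 + d := ⟨i - 1, by omega⟩
  exact entry_eq_zero_of_row T le_rfl (by omega) (by omega) h d j (by omega) h2

/-- This column borders the triangle of zeros below the middle segment, so the local rule copies its
top entry downwards. -/
theorem entry_next_column {n s : ℕ} {T : ST (2 * n - 1)} (hsn : s + 2 ≤ n)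
    (h : ∀ j, n - s ≤ j → j ≤ n + s → entry T 1 j = 0) {i : ℕ} (hi : 1 ≤ i)
    (hi2 : i ≤ 2 * s + 2) : entry T i (n + s + 1) = entry T 1 (n + s + 1) := by
  induction i, hi using Nat.le_induction with
  | base => rfl
  | succ i hi ih =>
    rw [entry_succ_succ T hi (by omega) (by omega), ih (by omega),
      entry_eq_zero_of_middle (by omega) h hi (by omega) le_rfl, zero_add]

/-- The top entry recurs down the whole column next to the zeros. For large s, rotation moves one of
the copies into the zeros. -/
theorem entry_one_next_eq_zero {n s : ℕ} (hs : n ≤ 3 * s + 3) (hsn : s + 2 ≤ n)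
    {T : ST (2 * n - 1)} (hr : rot T = T)
    (h : ∀ j, n - s ≤ j → j ≤ n + s → entry T 1 j = 0) : entry T 1 (n + s + 1) = 0 := by
  rcases hs.lt_or_eq with hlt | rfl
  -- The copy in row n-s is rotated to (n-s-1, 2n-2s-2), on the left edge of the triangle of zeros;
  -- n ≤ 3s+2 keeps it inside.
  · rw [← entry_next_column hsn h (by omega : 1 ≤ n - s) (by omega),
      ← entry_of_rot_rot_eq hr (by omega) (by omega) (by omega)]
    exact entry_eq_zero_of_middle (by omega) h (by omega) (by omega) (by omega)
  -- In the extremal case n = 3s+3 the copy in row 2s+2 is one of the three central entries.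
  -- Rotation makes them equal to some x, and the local rule says x = x + x.
  · have e1 := entry_next_column hsn h (by omega : 1 ≤ 2 * s + 2) le_rfl
    have e2 := entry_of_rot_eq hr (by omega : 1 ≤ 2 * s + 2)
      (by omega : 2 * s + 2 ≤ 3 * s + 3 + s + 1) (by omega)
    have e3 := entry_of_rot_rot_eq hr (by omega : 1 ≤ 2 * s + 2)
      (by omega : 2 * s + 2 ≤ 3 * s + 3 + s + 1) (by omega)
    have e4 := entry_succ_succ T (by omega : 1 ≤ 2 * s + 2)
      (by omega : 2 * s + 2 ≤ 3 * s + 3 + s) (by omega)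
    rw [show 3 * s + 3 + s + 1 - (2 * s + 2) + 1 = 2 * s + 2 + 1 by omega,
      show 2 * (3 * s + 3) - 1 - (2 * s + 2) + 1 = 3 * s + 3 + s + 1 by omega] at e2
    rw [show 2 * (3 * s + 3) - 1 - (3 * s + 3 + s + 1) + 1 = 2 * s + 2 by omega,
      show 2 * (3 * s + 3) - 1 - (3 * s + 3 + s + 1) + (2 * s + 2) = 3 * s + 3 + s by omega] at e3
    rwa [e2, e3, CharTwo.add_self_eq_zero, e1] at e4

theorem entry_middle_extend {n : ℕ} {T : ST (2 * n - 1)} (hr : rot T = T) (hh : hrefl T = T)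
    (h : ∀ j, n - (n - 1) / 3 ≤ j → j ≤ n + (n - 1) / 3 → entry T 1 j = 0) {s : ℕ}
    (hs : (n - 1) / 3 ≤ s) (hsn : s + 1 ≤ n) :
    ∀ j, n - s ≤ j → j ≤ n + s → entry T 1 j = 0 := by
  induction s, hs using Nat.le_induction with
  | base => exact h
  | succ s hs ih =>
    have ih := ih (by omega)
    have h1 := entry_one_next_eq_zero (by omega) (by omega) hr ih
    have h2 : entry T 1 (n - s - 1) = 0 := by
      rw [← h1, ← entry_of_hrefl_eq hh le_rfl (by omega : 1 ≤ n + s + 1) (by omega)]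
      congr 1
      omega
    intro j hj1 hj2
    rcases lt_or_ge j (n - s) with hj | hj
    · rwa [show j = n - s - 1 by omega]
    · rcases lt_or_ge (n + s) j with hj' | hj'
      · rwa [show j = n + s + 1 by omega]
      · exact ih j hj hj'

theorem eq_zero_of_entry_middle_eq_zero {n : ℕ} (hn : 1 ≤ n) {T : ST (2 * n - 1)}
    (hT : T ∈ DSTzero (2 * n - 1))
    (h : ∀ t, t < (n - 1) / 3 → entry T 1 (n - (t + 1)) = 0) : T = 0 := by
  obtain ⟨hr, hh, h0⟩ := (mem_DSTzero_iff hn).1 hT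
  have hleft : ∀ j, n - (n - 1) / 3 ≤ j → j ≤ n → entry T 1 j = 0 := by
    intro j hj1 hj2
    rcases hj2.lt_or_eq with hj | rfl
    · have := h (n - j - 1) (by omega)
      rwa [show n - (n - j - 1 + 1) = j by omega] at this
    · exact h0
  have hmid : ∀ j, n - (n - 1) / 3 ≤ j → j ≤ n + (n - 1) / 3 → entry T 1 j = 0 := by
    intro j hj1 hj2
    rcases le_total j n with hj | hj
    · exact hleft j hj1 hj
    · rw [← entry_of_hrefl_eq hh le_rfl (by omega) (by omega)]
      exact hleft _ (by omega) (by omega)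
  refine ST_ext_firstRow fun j hj1 hj2 => ?_
  rw [entry_zero]
  exact entry_middle_extend hr hh hmid (by omega : (n - 1) / 3 ≤ n - 1) (by omega) j (by omega)
    (by omega)

instance finite_TriIdx (m : ℕ) : Finite (TriIdx m) :=
  Set.Finite.subset (Set.finite_Iic (m, m)) fun p hp =>
    show p ≤ (m, m) from ⟨hp.2.1.trans hp.2.2, hp.2.2⟩

theorem finrank_DSTzero_le {n : ℕ} (hn : 1 ≤ n) :
    Module.finrank (ZMod 2) (DSTzero (2 * n - 1)) ≤ (n - 1) / 3 := by
  let φ : DSTzero (2 * n - 1) →ₗ[ZMod 2] (Fin ((n - 1) / 3) → ZMod 2) :=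
    LinearMap.pi fun t => entryFunctional 1 (n - (t + 1)) ∘ₗ (DSTzero (2 * n - 1)).subtype
  have hφ : Function.Injective φ := by
    rw [← LinearMap.ker_eq_bot, LinearMap.ker_eq_bot']
    intro T hT
    exact Subtype.ext (eq_zero_of_entry_middle_eq_zero hn T.2 fun t ht => congrFun hT ⟨t, ht⟩)
  simpa using LinearMap.finrank_le_finrank_of_injective hφ

/-- The basis of the space of dihedrally symmetric triangles given by binomial coefficients. -/
theorem exists_basis_DSTzero {n : ℕ} (hn : 1 ≤ n) :
    ∃ b : Module.Basis (Fin ((n - 1) / 3)) (ZMod 2) (DSTzero (2 * n - 1)),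
      ∀ k, b k = ⟨rho (binomTriangle n k), rho_binomTriangle_mem hn k⟩ := by
  have hli : LinearIndependent (ZMod 2) fun k : Fin ((n - 1) / 3) =>
      (⟨rho (binomTriangle n k), rho_binomTriangle_mem hn k⟩ : DSTzero (2 * n - 1)) :=
    LinearIndependent.of_comp (DSTzero (2 * n - 1)).subtype (linearIndependent_rho_binomTriangle n)
  have hspan := hli.span_eq_top_of_card_eq_finrank' (by
    refine le_antisymm ?_ ?_
    · simpa using hli.fintype_card_le_finrank
    · simpa using finrank_DSTzero_le hn)
  exact ⟨Module.Basis.mk hli hspan.ge, fun k => Module.Basis.mk_apply hli hspan.ge k⟩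

/-! ## Triangles and the graphs of their even entries -/

/-- The local rule applied twice, with the doubled middle term cancelling mod 2: it also holds at
distance two. -/
theorem entry_add_two {m : ℕ} (T : ST m) {i j : ℕ} (hi : 1 ≤ i) (hij : i ≤ j) (hj : j + 2 ≤ m) :
    entry T (i + 2) (j + 2) = entry T i j + entry T i (j + 2) := by
  rw [entry_succ_succ T (by omega : 1 ≤ i + 1) (by omega : i + 1 ≤ j + 1) hj,
    entry_succ_succ T hi hij (by omega), entry_succ_succ T hi (by omega) hj, ← add_assoc,
    add_assoc (entry T i j), CharTwo.add_self_eq_zero, add_zero]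

/-- The sequence of the entries in the even columns of the second row. -/
def evenEntries {n : ℕ} (T : ST (2 * n - 1)) : BinSeq (n - 1) := fun j => entry T 2 (2 * j.1)

theorem entry_nabla_evenEntries {n : ℕ} (T : ST (2 * n - 1)) {i j : ℕ} (hi : 1 ≤ i) (hij : i ≤ j)
    (hj : j ≤ n - 1) : entry (nabla (evenEntries T)) i j = entry T (2 * i) (2 * j) := by
  induction i, hi using Nat.le_induction generalizing j with
  | base => rw [entry_nabla_one _ (Finset.mem_Icc.2 ⟨hij, hj⟩), evenEntries]
  | succ i hi ih =>
    obtain ⟨j, rfl⟩ : ∃ d, j = d + 1 := ⟨j - 1, by omega⟩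
    rw [entry_succ_succ _ hi (by omega) hj, ih (by omega) (by omega), ih (by omega) (by omega),
      mul_add, mul_add, mul_one, entry_add_two T (by omega) (by omega) (by omega)]

theorem adj_of_lt_eq_entry {n : ℕ} (S : BinSeq (n - 1)) {u v : Idx n} (h : u.1 < v.1) :
    (steinhausGraph n S).adj u v = entry (nabla S) u.1 (v.1 - 1) := by
  have hu := Finset.mem_Icc.1 u.2
  have hv := Finset.mem_Icc.1 v.2
  rw [SG.adj_of_lt _ h, entry_of_mem _ (by omega : 1 ≤ u.1 ∧ u.1 ≤ v.1 - 1 ∧ v.1 - 1 ≤ n - 1)]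
  simp [steinhausGraph]

theorem sum_Icc_eq_sum_Ico (f : ℕ → ZMod 2) (a b : ℕ) :
    ∑ q ∈ Finset.Icc a b, f q = ∑ q ∈ Finset.Ico a (b + 1), f q := by
  rw [Finset.Ico_add_one_right_eq_Icc]

theorem sum_adj {n : ℕ} (S : BinSeq (n - 1)) (u : Idx n) :
    ∑ v, (steinhausGraph n S).adj u v =
      ∑ i ∈ Finset.Ico 1 u.1, entry (nabla S) i (u.1 - 1) +
        ∑ j ∈ Finset.Ico u.1 n, entry (nabla S) u.1 j := by
  have hu := Finset.mem_Icc.1 u.2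
  let f : ℕ → ZMod 2 := fun v =>
    if v < u.1 then entry (nabla S) v (u.1 - 1) else
      if v = u.1 then 0 else entry (nabla S) u.1 (v - 1)
  have hf : ∀ v : Idx n, (steinhausGraph n S).adj u v = f v.1 := by
    intro v
    rcases lt_trichotomy u.1 v.1 with h | h | h
    · simp only [f]
      rw [if_neg (by omega), if_neg (by omega), adj_of_lt_eq_entry S h]
    · obtain rfl : u = v := Subtype.ext h
      simp only [f]
      rw [if_neg (by omega), SG.adj_self]
      exact (if_pos trivial).symm
    · simp only [f]
      rw [if_pos h, SG.adj_symm, adj_of_lt_eq_entry S h]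
  rw [Finset.sum_congr rfl fun v _ => hf v, sum_Idx f,
    sum_Icc_eq_sum_Ico f, ← Finset.sum_Ico_consecutive f hu.1 (by omega : u.1 ≤ n + 1)]
  congr 1
  · refine Finset.sum_congr rfl fun v hv => ?_
    simp only [f]
    rw [if_pos (Finset.mem_Ico.1 hv).2]
  · rw [Finset.sum_eq_sum_Ico_succ_bot (by omega), ← Finset.sum_Ico_add' f u.1 n 1]
    have h0 : f u.1 = 0 := by simp [f]
    rw [h0, zero_add]
    refine Finset.sum_congr rfl fun v hv => ?_
    have := (Finset.mem_Ico.1 hv).1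
    simp only [f]
    rw [if_neg (by omega), if_neg (by omega), Nat.add_sub_cancel]

/-- Each entry of row 2v in an even column is the sum of two neighbours in row 2v-1. These pairs
cover that row except for its last entry. -/
theorem sum_even_row {n : ℕ} (T : ST (2 * n - 1)) {v : ℕ} (hv : 1 ≤ v) (hvn : v ≤ n) :
    ∑ j ∈ Finset.Ico v n, entry T (2 * v) (2 * j) =
      ∑ q ∈ Finset.Icc (2 * v - 1) (2 * n - 1), entry T (2 * v - 1) q +
        entry T (2 * v - 1) (2 * n - 1) := by
  have h : ∀ j ∈ Finset.Ico v n, entry T (2 * v) (2 * j) =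
      (fun q => entry T (2 * v - 1) (q - 1)) (2 * j) +
      (fun q => entry T (2 * v - 1) (q - 1)) (2 * j + 1) := by
    intro j hj
    rw [Finset.mem_Ico] at hj
    have := entry_succ_succ T (by omega : 1 ≤ 2 * v - 1) (by omega : 2 * v - 1 ≤ 2 * j - 1)
      (by omega)
    rwa [show 2 * v - 1 + 1 = 2 * v by omega, show 2 * j - 1 + 1 = 2 * j by omega] at this
  rw [Finset.sum_congr rfl h, sum_Ico_pairs (fun q => entry T (2 * v - 1) (q - 1)) hvn,
    sum_Icc_eq_sum_Ico,
    Finset.sum_Ico_succ_top (by omega), add_assoc, CharTwo.add_self_eq_zero, add_zero]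
  have := Finset.sum_Ico_add' (fun q => entry T (2 * v - 1) (q - 1)) (2 * v - 1) (2 * n - 1) 1
  rw [show 2 * v - 1 + 1 = 2 * v by omega, show 2 * n - 1 + 1 = 2 * n by omega] at this
  exact this.symm

/-- By the local rule, each entry of column 2v-2 in an even row is the sum of two vertical
neighbours in column 2v-1. These pairs cover that column except for its first entry. -/
theorem sum_even_column {n : ℕ} (T : ST (2 * n - 1)) {v : ℕ} (hv : 1 ≤ v) (hvn : v ≤ n) :
    ∑ i ∈ Finset.Ico 1 v, entry T (2 * i) (2 * (v - 1)) =
      ∑ i ∈ Finset.Icc 1 (2 * v - 1), entry T i (2 * v - 1) + entry T 1 (2 * v - 1) := by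
  have h : ∀ i ∈ Finset.Ico 1 v, entry T (2 * i) (2 * (v - 1)) =
      (fun q => entry T q (2 * v - 1)) (2 * i) +
      (fun q => entry T q (2 * v - 1)) (2 * i + 1) := by
    intro i hi
    rw [Finset.mem_Ico] at hi
    have := entry_succ_succ T (by omega : 1 ≤ 2 * i) (by omega : 2 * i ≤ 2 * (v - 1)) (by omega)
    rw [show 2 * (v - 1) + 1 = 2 * v - 1 by omega] at this
    dsimp only
    rw [this, add_left_comm, CharTwo.add_self_eq_zero, add_zero]
  rw [Finset.sum_congr rfl h, sum_Ico_pairs (fun q => entry T q (2 * v - 1)) hv,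
    sum_Icc_eq_sum_Ico, show 2 * v - 1 + 1 = 2 * v by omega,
    Finset.sum_eq_sum_Ico_succ_bot (by omega : 1 < 2 * v), add_comm (entry T 1 _), add_assoc,
    CharTwo.add_self_eq_zero (entry T 1 _), add_zero]

/-- Below the first row, an entry on the axis of `hrefl` is the sum of two mirror images two rows
above. -/
theorem entry_axis_eq_zero {n : ℕ} {T : ST (2 * n - 1)} (hh : hrefl T = T)
    (h0 : entry T 1 n = 0) {v : ℕ} (hv : 1 ≤ v) (hvn : v ≤ n) :
    entry T (2 * v - 1) (n + v - 1) = 0 := by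
  rcases hv.eq_or_lt with rfl | hv
  · exact h0
  · have h1 := entry_add_two T (by omega : 1 ≤ 2 * v - 3) (by omega : 2 * v - 3 ≤ n + v - 3)
      (by omega)
    have h2 := entry_of_hrefl_eq hh (by omega : 1 ≤ 2 * v - 3)
      (by omega : 2 * v - 3 ≤ n + v - 3) (by omega)
    rw [show 2 * v - 3 + 2 = 2 * v - 1 by omega, show n + v - 3 + 2 = n + v - 1 by omega] at h1
    rw [show 2 * n - 1 - (n + v - 3) + (2 * v - 3) = n + v - 1 by omega] at h2
    rw [h1, h2, CharTwo.add_self_eq_zero]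

theorem sum_odd_row_eq_zero {n : ℕ} {T : ST (2 * n - 1)} (hh : hrefl T = T)
    (h0 : entry T 1 n = 0) {v : ℕ} (hv : 1 ≤ v) (hvn : v ≤ n) :
    ∑ q ∈ Finset.Icc (2 * v - 1) (2 * n - 1), entry T (2 * v - 1) q = 0 := by
  rw [sum_Icc_of_symm_middle (c := n + v - 1) (fun q h1 h2 => ?_) (by omega) (by omega),
    entry_axis_eq_zero hh h0 hv hvn]
  rw [← entry_of_hrefl_eq hh (by omega) h1 h2]
  congr 1
  omega

theorem mem_ESG_iff {n : ℕ} {T : ST (2 * n - 1)} (hh : hrefl T = T) (h0 : entry T 1 n = 0) :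
    steinhausGraph n (evenEntries T) ∈ ESG n ↔ ∀ v, 1 ≤ v → v ≤ n →
      ∑ i ∈ Finset.Icc 1 (2 * v - 1), entry T i (2 * v - 1) + entry T 1 (2 * v - 1) +
        entry T (2 * v - 1) (2 * n - 1) = 0 := by
  have key : ∀ u : Idx n, ∑ v, (steinhausGraph n (evenEntries T)).adj u v =
      ∑ i ∈ Finset.Icc 1 (2 * u.1 - 1), entry T i (2 * u.1 - 1) + entry T 1 (2 * u.1 - 1) +
        entry T (2 * u.1 - 1) (2 * n - 1) := by
    intro u
    have hu := Finset.mem_Icc.1 u.2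
    rw [sum_adj, ← sum_even_column T hu.1 hu.2, ← zero_add (entry T (2 * u.1 - 1) (2 * n - 1)),
      ← sum_odd_row_eq_zero hh h0 hu.1 hu.2, ← sum_even_row T hu.1 hu.2]
    congr 1
    · refine Finset.sum_congr rfl fun i hi => ?_
      rw [Finset.mem_Ico] at hi
      exact entry_nabla_evenEntries T hi.1 (by omega) (by omega)
    · refine Finset.sum_congr rfl fun j hj => ?_
      rw [Finset.mem_Ico] at hj
      exact entry_nabla_evenEntries T hu.1 hj.1 (by omega)
  change SG.IsEven _ ↔ _
  rw [SG.isEven_iff]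
  constructor
  · intro h v hv hvn
    rw [← key ⟨v, Finset.mem_Icc.2 ⟨hv, hvn⟩⟩, h]
  · intro h u
    have hu := Finset.mem_Icc.1 u.2
    rw [key, h u.1 hu.1 hu.2]

theorem steinhausGraph_evenEntries_mem_ESG {n : ℕ} (hn : 1 ≤ n) {T : ST (2 * n - 1)}
    (hT : T ∈ DSTzero (2 * n - 1)) : steinhausGraph n (evenEntries T) ∈ ESG n := by
  obtain ⟨hr, hh, h0⟩ := (mem_DSTzero_iff hn).1 hT
  refine (mem_ESG_iff hh h0).2 fun v hv hvn => ?_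
  rw [sum_Icc_of_symm_middle (c := v) (fun q h1 h2 => ?_) (by omega) (by omega)]
  -- The two corner terms are rotations of each other, and the middle entry of column 2v-1 is
  -- rotated onto the axis of `hrefl`, where the triangle vanishes.
  · have h1 := entry_of_rot_eq hr le_rfl (by omega : 1 ≤ 2 * v - 1) (by omega)
    have h2 := entry_axis_eq_zero hh h0 (by omega : 1 ≤ n - v + 1) (by omega)
    have h3 := entry_of_rot_rot_eq hr hv (by omega : v ≤ 2 * v - 1) (by omega)
    rw [show 2 * v - 1 - 1 + 1 = 2 * v - 1 by omega,
      show 2 * n - 1 - 1 + 1 = 2 * n - 1 by omega] at h1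
    rw [show 2 * n - 1 - (2 * v - 1) + 1 = 2 * (n - v + 1) - 1 by omega,
      show 2 * n - 1 - (2 * v - 1) + v = n + (n - v + 1) - 1 by omega, h2] at h3
    rw [h1, ← h3, zero_add, CharTwo.add_self_eq_zero]
  · rw [← entry_column_symm hr hh h1 h2 (by omega)]
    congr 1
    omega

/-- Column j+1 consists of the partial sums of column j, up to a constant. If column j is symmetric
with total zero, its partial sums are symmetric as well. -/
theorem entry_column_symm_of_mem_ESG {n : ℕ} {T : ST (2 * n - 1)} (hh : hrefl T = T)
    (h0 : entry T 1 n = 0) (hE : steinhausGraph n (evenEntries T) ∈ ESG n) {j : ℕ} (hj1 : 1 ≤ j)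
    (hj : j ≤ 2 * n - 1) : ∀ i, 1 ≤ i → i ≤ j → entry T (j - i + 1) j = entry T i j := by
  have hE := (mem_ESG_iff hh h0).1 hE
  induction j, hj1 using Nat.le_induction with
  | base =>
    intro i hi hij
    obtain rfl : i = 1 := by omega
    rfl
  | succ j hj1 ih =>
    have ih := ih (by omega)
    have hsum : ∀ d, d ≤ j → entry T (d + 1) (j + 1) =
        ∑ i ∈ Finset.Icc 1 d, entry T i j + entry T 1 (j + 1) := by
      intro d hd
      induction d with
      | zero => simp
      | succ d ihd =>
        rw [entry_succ_succ T (by omega) hd hj, ihd (by omega),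
          Finset.sum_Icc_succ_top (by omega), ← add_assoc, add_comm (entry T (d + 1) j)]
    -- For even j symmetry alone suffices. For odd j the total is the degree of vertex (j+1)/2 plus
    -- two corner terms, which agree by symmetry of column j and `hrefl`.
    have hcol : ∑ i ∈ Finset.Icc 1 j, entry T i j = 0 := by
      rcases Nat.even_or_odd j with he | ho
      · refine sum_Icc_of_symm (fun q h1 h2 => ?_) (by rw [add_comm]; exact he.add_one)
        rw [← ih q h1 h2]
        congr 1
        omega
      · obtain ⟨w, rfl⟩ := ho
        have h1 := hE (w + 1) (by omega) (by omega)
        have h2 := ih 1 le_rfl hj1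
        have h3 := entry_of_hrefl_eq hh hj1 (by omega : 2 * w + 1 ≤ 2 * n - 1) le_rfl
        rw [show 2 * n - 1 - (2 * n - 1) + (2 * w + 1) = 2 * w + 1 by omega] at h3
        rw [show 2 * w + 1 - 1 + 1 = 2 * w + 1 by omega] at h2
        rwa [show 2 * (w + 1) - 1 = 2 * w + 1 by omega, ← h3, h2, add_assoc,
          CharTwo.add_self_eq_zero, add_zero] at h1
    intro i hi hij
    obtain ⟨d, rfl⟩ : ∃ d, i = d + 1 := ⟨i - 1, by omega⟩
    rw [hsum d (by omega), show j + 1 - (d + 1) + 1 = (j - d) + 1 by omega, hsum (j - d) (by omega)]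
    congr 1
    have hsplit : ∑ q ∈ Finset.Icc 1 d, entry T q j + ∑ q ∈ Finset.Icc (d + 1) j, entry T q j =
        0 := by
      rw [← hcol]
      rw [sum_Icc_eq_sum_Ico, sum_Icc_eq_sum_Ico, sum_Icc_eq_sum_Ico, Finset.sum_Ico_consecutive _ (by omega) (by omega)]
    rw [CharTwo.add_eq_zero] at hsplit
    rw [hsplit]
    refine Finset.sum_nbij' (fun q => j + 1 - q) (fun q => j + 1 - q) ?_ ?_ ?_ ?_ ?_
    · intro q hq
      rw [Finset.mem_Icc] at hq ⊢
      omega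
    · intro q hq
      rw [Finset.mem_Icc] at hq ⊢
      omega
    · intro q hq
      rw [Finset.mem_Icc] at hq
      omega
    · intro q hq
      rw [Finset.mem_Icc] at hq
      omega
    · intro q hq
      rw [Finset.mem_Icc] at hq
      rw [← ih q hq.1 (by omega)]
      congr 1
      omega

theorem mem_DSTzero_of_mem_ESG {n : ℕ} (hn : 1 ≤ n) {T : ST (2 * n - 1)} (hh : hrefl T = T)
    (h0 : entry T 1 n = 0) (hE : steinhausGraph n (evenEntries T) ∈ ESG n) :
    T ∈ DSTzero (2 * n - 1) :=
  (mem_DSTzero_iff hn).2 ⟨rot_eq_of_column_symm hh fun _ _ hi hij hj =>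
    entry_column_symm_of_mem_ESG hh h0 hE (hi.trans hij) hj _ hi hij, hh, h0⟩

/-- The increments of the first row of the symmetric triangle with prescribed even entries. -/
def increment {n : ℕ} (S : BinSeq (n - 1)) (q : ℕ) : ZMod 2 :=
  -- The increment from q to q+1 is the entry (2, q+1), which is prescribed for odd q; for even q it
  -- is copied from 2n-1-q. At q = 0 and q = 2n-1, `extend` is read at n and gives 0.
  if q % 2 = 1 then extend S ((q + 1) / 2) else extend S (n - q / 2)

/-- The symmetric sequence, zero in the middle, with prescribed increments. -/
def symmSeq {n : ℕ} (S : BinSeq (n - 1)) (p : ℕ) : ZMod 2 :=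
  -- The second sum is a constant that makes the value at n zero.
  ∑ q ∈ Finset.range p, increment S q + ∑ q ∈ Finset.range n, increment S q

theorem symmSeq_succ {n : ℕ} (S : BinSeq (n - 1)) (p : ℕ) :
    symmSeq S (p + 1) = symmSeq S p + increment S p := by
  rw [symmSeq, symmSeq, Finset.sum_range_succ, add_right_comm]

theorem increment_symm {n : ℕ} (S : BinSeq (n - 1)) {q : ℕ} (hq : q + 1 ≤ 2 * n) :
    increment S (2 * n - 1 - q) = increment S q := by
  unfold increment
  split_ifs with h1 h2 h2
  · omega
  · congr 1
    omega
  · congr 1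
    omega
  · omega

theorem symmSeq_symm {n : ℕ} (S : BinSeq (n - 1)) {t : ℕ} (ht : t ≤ n) :
    symmSeq S (n + t) = symmSeq S (n - t) := by
  induction t with
  | zero => rfl
  | succ t ih =>
    have h := symmSeq_succ S (n - (t + 1))
    rw [show n - (t + 1) + 1 = n - t by omega] at h
    rw [← add_assoc, symmSeq_succ, ih (by omega), h, ← increment_symm S (by omega : n + t + 1 ≤ 2 * n),
      show 2 * n - 1 - (n + t) = n - (t + 1) by omega, add_assoc, CharTwo.add_self_eq_zero,
      add_zero]

theorem exists_symm_triangle {n : ℕ} (hn : 1 ≤ n) (S : BinSeq (n - 1)) :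
    ∃ T : ST (2 * n - 1), hrefl T = T ∧ entry T 1 n = 0 ∧ evenEntries T = S := by
  have hrow : ∀ p, 1 ≤ p → p ≤ 2 * n - 1 →
      entry (nabla (n := 2 * n - 1) fun j => symmSeq S j.1) 1 p = symmSeq S p :=
    fun p h1 h2 => entry_nabla_one _ (Finset.mem_Icc.2 ⟨h1, h2⟩)
  refine ⟨nabla fun j => symmSeq S j.1, ST_ext_firstRow fun j h1 h2 => ?_, ?_, ?_⟩
  · rw [entry_hrefl _ le_rfl h1 h2, hrow _ (by omega) (by omega), hrow _ h1 h2]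
    rcases le_total j n with hj | hj
    · have := symmSeq_symm S (by omega : n - j ≤ n)
      rwa [show n + (n - j) = 2 * n - 1 - j + 1 by omega, show n - (n - j) = j by omega] at this
    · have := symmSeq_symm S (by omega : j - n ≤ n)
      rwa [show n + (j - n) = j by omega, show n - (j - n) = 2 * n - 1 - j + 1 by omega,
        eq_comm] at this
  · rw [hrow _ hn (by omega), symmSeq, CharTwo.add_self_eq_zero]
  · funext j
    have hj := Finset.mem_Icc.1 j.2
    have h := entry_succ_succ (nabla (n := 2 * n - 1) fun j => symmSeq S j.1) le_rfl
      (by omega : 1 ≤ 2 * j.1 - 1) (by omega)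
    rw [hrow _ (by omega) (by omega), hrow _ (by omega) (by omega), symmSeq_succ, ← add_assoc,
      CharTwo.add_self_eq_zero (symmSeq S _), zero_add,
      show 2 * j.1 - 1 + 1 = 2 * j.1 by omega] at h
    rw [evenEntries, h, increment, if_pos (by omega),
      show (2 * j.1 - 1 + 1) / 2 = j.1 by omega, extend, dif_pos j.2]

/-! ### The isomorphism onto the even Steinhaus graphs -/

theorem psi_apply {n : ℕ} (T : DSTzero (2 * n - 1)) :
    psi n T = steinhausGraph n (evenEntries T.1) := by
  change steinhausGraph n _ = _
  congr 1
  funext j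
  have := Finset.mem_Icc.1 j.2
  rw [evenEntries, entry_of_mem T.1 (by omega : 1 ≤ 2 ∧ 2 ≤ 2 * j.1 ∧ 2 * j.1 ≤ 2 * n - 1)]

theorem steinhausGraph_firstRow {n : ℕ} (G : SG n) :
    steinhausGraph n (firstRow (SG.linearEquivST n G)) = G := by
  simp [steinhausGraph, nabla_firstRow]

theorem steinhausGraph_injective (n : ℕ) : Function.Injective (steinhausGraph n) := by
  intro S S' h
  have h' := (SG.linearEquivST n).symm.injective h
  rw [← firstRow_nabla S, h', firstRow_nabla]

theorem range_psi {n : ℕ} (hn : 1 ≤ n) : LinearMap.range (psi n) = ESG n := by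
  ext G
  rw [LinearMap.mem_range]
  constructor
  · rintro ⟨T, rfl⟩
    rw [psi_apply]
    exact steinhausGraph_evenEntries_mem_ESG hn T.2
  · intro hG
    obtain ⟨T, hh, h0, hS⟩ := exists_symm_triangle hn (firstRow (SG.linearEquivST n G))
    have hG' : steinhausGraph n (evenEntries T) = G := by rw [hS, steinhausGraph_firstRow]
    exact ⟨⟨T, mem_DSTzero_of_mem_ESG hn hh h0 (hG'.symm ▸ hG)⟩, by rw [psi_apply, hG']⟩

/-- If the graph is zero, the increments of the first row vanish at odd positions, hence by
reflection at even ones. The first row is then constant, and its middle entry is zero. -/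
theorem psi_injective {n : ℕ} (hn : 1 ≤ n) : Function.Injective (psi n) := by
  rw [← LinearMap.ker_eq_bot, LinearMap.ker_eq_bot']
  intro T hT
  obtain ⟨-, hh, h0⟩ := (mem_DSTzero_iff hn).1 T.2
  rw [psi_apply, ← map_zero (steinhausGraph n)] at hT
  have hS := steinhausGraph_injective n hT
  have hodd : ∀ j, 1 ≤ j → j ≤ n - 1 → entry T.1 1 (2 * j) = entry T.1 1 (2 * j - 1) := by
    intro j h1 h2
    have h3 : entry T.1 2 (2 * j) = 0 := congrFun hS ⟨j, Finset.mem_Icc.2 ⟨h1, h2⟩⟩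
    have h4 := entry_succ_succ T.1 le_rfl (by omega : 1 ≤ 2 * j - 1) (by omega)
    rw [show 2 * j - 1 + 1 = 2 * j by omega, h3, eq_comm, CharTwo.add_eq_zero] at h4
    exact h4.symm
  have hrefl' : ∀ j, 1 ≤ j → j ≤ 2 * n - 1 → entry T.1 1 (2 * n - j) = entry T.1 1 j := by
    intro j h1 h2
    rw [← entry_of_hrefl_eq hh le_rfl h1 h2]
    congr 1
    omega
  have hstep : ∀ j, 1 ≤ j → j + 1 ≤ 2 * n - 1 → entry T.1 1 (j + 1) = entry T.1 1 j := by
    intro j h1 h2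
    rcases Nat.even_or_odd' j with ⟨i, rfl | rfl⟩
    · have h3 := hodd (n - i) (by omega) (by omega)
      rw [← hrefl' _ (by omega) (by omega), ← hrefl' (2 * (n - i) - 1) (by omega) (by omega),
        show 2 * n - 2 * (n - i) = 2 * i by omega,
        show 2 * n - (2 * (n - i) - 1) = 2 * i + 1 by omega] at h3
      exact h3.symm
    · exact hodd (i + 1) (by omega) (by omega)
  have hconst : ∀ j, 1 ≤ j → j ≤ 2 * n - 1 → entry T.1 1 j = entry T.1 1 1 := by
    intro j h1
    induction j, h1 using Nat.le_induction with
    | base => intro _; rfl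
    | succ j h1 ih => intro h2; rw [hstep j h1 h2, ih (by omega)]
  refine Subtype.ext (ST_ext_firstRow fun j h1 h2 => ?_)
  change entry T.1 1 j = entry 0 1 j
  rw [hconst j h1 h2, ← hconst n hn (by omega), h0, entry_zero]

theorem evenEntries_rho_binomTriangle (n k : ℕ) :
    evenEntries (rho (binomTriangle n k)) = basisSeq n k := by
  funext j
  have hj := Finset.mem_Icc.1 j.2
  rw [evenEntries, entry_rho_binomTriangle n k (by omega) (by omega) (by omega), basisSeq]
  push_cast
  congr 4 <;> ring

end Steinhaus

theorem theorem9 (n : ℕ) (hn : 1 ≤ n) :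
    ∃ hD : ∀ k : Fin ((n - 1) / 3),
        rho (nabla (pascalColumn (2 * n - 1) (2 * ((k : ℕ) : ℤ) + 1) (((k : ℕ) : ℤ) - n + 1))) ∈
          DSTzero (2 * n - 1),
      (∃ b : Module.Basis (Fin ((n - 1) / 3)) (ZMod 2) (ESG n),
        ∀ k, (b k : SG n) =
          psi n ⟨rho (nabla (pascalColumn (2 * n - 1) (2 * ((k : ℕ) : ℤ) + 1) (((k : ℕ) : ℤ) - n + 1))),
            hD k⟩) ∧
      ∀ k : Fin ((n - 1) / 3),
        psi n ⟨rho (nabla (pascalColumn (2 * n - 1) (2 * ((k : ℕ) : ℤ) + 1) (((k : ℕ) : ℤ) - n + 1))),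
            hD k⟩ =
          steinhausGraph n (basisSeq n k) := by
  refine ⟨fun k => rho_binomTriangle_mem hn k, ?_, fun k => ?_⟩
  · obtain ⟨b, hb⟩ := exists_basis_DSTzero hn
    -- The isomorphism induced by `psi n` carries the basis of `DSTzero (2 * n - 1)` to the required
    -- one.
    let e : DSTzero (2 * n - 1) ≃ₗ[ZMod 2] ESG n :=
      (LinearEquiv.ofInjective (psi n) (psi_injective hn)).trans
        (LinearEquiv.ofEq _ _ (range_psi hn))
    refine ⟨b.map e, fun k => ?_⟩
    rw [Module.Basis.map_apply, hb]
    rfl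
  · rw [psi_apply, ← evenEntries_rho_binomTriangle]
    rfl
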